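/- Let $\mathsf{k}\in\mathbb N$ and let $\mathbb F_\theta^+$ be a single vertex $\mathsf{k}$-graph: the unital semigroup generated by $e^i_{\mathfrak s}$ ($1\le i\le \mathsf{k}$, $1\le \mathfrak s\le m_i$) subject to the relations $e^i_{\mathfrak s}e^j_{\mathfrak t}=e^j_{\mathfrak t'}e^i_{\mathfrak s'}$ whenever $i<j$ and $\theta_{ij}(\mathfrak s,\mathfrak t)=(\mathfrak s',\mathfrak t')$, where the $\theta_{ij}$ are permutations of $\{1,\dots,m_i\}\times\{1,\dots,m_j\}$ satisfying the cubic condition: for all $i<j<l$ the two ways of rewriting a word $e^i_{a}e^j_{b}e^l_{c}$ in the form $e^l_{c'}e^j_{b'}e^i_{a'}$ by these relations agree. Assume $m_i\ge 2$ for every $i$. Let $d:\mathbb F_\theta^+\to\mathbb N^{\mathsf{k}}$ be the degree map, with $d(e^i_{\mathfrak s})=\varepsilon_i$ (the $i$-th standard generator), and for $\mu,\nu\in\mathbb F_\theta^+$ put $$\Lambda^{\min}(\mu,\nu)=\{(\xi,\eta): \mu\xi=\nu\eta,\ d(\mu\xi)=d(\mu)\vee d(\nu)\}.$$ $\mathbb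 F_\theta^+$ has the little pull-back property if $|\Lambda^{\min}(e,f)|\le 1$ for all generators $e,f$ of distinct degrees. Let $\mathcal O_\theta$ be the universal unital C*-algebra generated by elements $s^i_{\mathfrak s}$ with $(s^i_{\mathfrak s})^*s^i_{\mathfrak t}=\delta_{\mathfrak s,\mathfrak t}I$, $\sum_{\mathfrak s}s^i_{\mathfrak s}(s^i_{\mathfrak s})^*=I$, and $s^i_{\mathfrak s}s^j_{\mathfrak t}=s^j_{\mathfrak t'}s^i_{\mathfrak s'}$ whenever $i<j$ and $\theta_{ij}(\mathfrak s,\mathfrak t)=(\mathfrak s',\mathfrak t')$; write $s_w$ for the product of generators corresponding to $w\in\mathbb F_\theta^+$. Let $$\mathcal X_0=\operatorname{span}\{s_us_v^*: u,v\in\mathbb F_\theta^+,\ d(u)=d(v)\},$$ let $\mathcal U(\mathcal X_0)$ be the group of unitaries of $\mathcal O_\theta$ lying in $\mathcal X_0$, and let $\mathsf{Ave}(\mathcal O_\theta,\mathcal U(\mathcal X_0))$ be the set of all maps $\alpha(A)=\sum_{i=1}^n\lambda_iU_iAU_i^*$ on $\mathcal O_\theta$ with $U_i\in\mathcal U(\mathcal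 X_0)$, $\lambda_i>0$ and $\sum_{i=1}^n\lambda_i=1$. Suppose that $\mathbb F_\theta^+$ has the little pull-back property. Then for each $A\in\mathcal O_\theta$, $$\overline{\{\alpha(A):\alpha\in\mathsf{Ave}(\mathcal O_\theta,\mathcal U(\mathcal X_0))\}}^{\|\cdot\|}\cap\mathbb C I\neq\varnothing .$$ -/

import Mathlib

open scoped ENNReal

noncomputable section

/-- The data defining a single vertex `k`-graph `𝔽_θ⁺`: the number `m i` of generators of each
colour `i`, and permutations `θ_{ij}` (`i < j`) satisfying the cubic condition.  Here
`θ_{ij}(s, t) = (s', t')` encodes the commutation relation `e^i_s e^j_t = e^j_{t'} e^i_{s'}`. -/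
structure SingleVertexKGraph (k : ℕ) where
  /-- `m i` is the number of generators of colour `i` -/
  m : Fin k → ℕ
  /-- the permutations `θ_{ij}` -/
  θ : ∀ ⦃i j : Fin k⦄, i < j → Equiv.Perm (Fin (m i) × Fin (m j))
  /-- The two ways of rewriting `e^i_a e^j_b e^l_c` as `e^l_* e^j_* e^i_*` agree:
  `ijl → ilj → lij → lji` on one side and `ijl → jil → jli → lji` on the other. -/
  cubic : ∀ ⦃i j l : Fin k⦄ (hij : i < j) (hjl : j < l)
    (a a₁ a₂ a₁' a₂' : Fin (m i)) (b b₁ b₂ b₁' b₂' : Fin (m j)) (c c₁ c₂ c₁' c₂' : Fin (m l)),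
    θ hjl (b, c) = (b₁, c₁) → θ (hij.trans hjl) (a, c₁) = (a₁, c₂) → θ hij (a₁, b₁) = (a₂, b₂) →
    θ hij (a, b) = (a₁', b₁') → θ (hij.trans hjl) (a₁', c) = (a₂', c₁') →
      θ hjl (b₁', c₁') = (b₂', c₂') →
    a₂ = a₂' ∧ b₂ = b₂' ∧ c₂ = c₂'

namespace SingleVertexKGraph

variable {k : ℕ} (Λ : SingleVertexKGraph k)

/-- The set of generators `e^i_s`, as formal symbols. -/
abbrev Gen : Type := Σ i : Fin k, Fin (Λ.m i)

/-- The `θ`-commutation relations. -/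
inductive Rel : FreeMonoid Λ.Gen → FreeMonoid Λ.Gen → Prop
  | comm {i j : Fin k} (h : i < j) (s s' : Fin (Λ.m i)) (t t' : Fin (Λ.m j))
      (hθ : Λ.θ h (s, t) = (s', t')) :
      Rel (FreeMonoid.of ⟨i, s⟩ * FreeMonoid.of ⟨j, t⟩)
        (FreeMonoid.of ⟨j, t'⟩ * FreeMonoid.of ⟨i, s'⟩)

/-- The unital semigroup `𝔽_θ⁺`. -/
abbrev Word : Type := PresentedMonoid Λ.Rel

/-- The generator (edge) `e^i_s` of `𝔽_θ⁺`. -/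
def e (i : Fin k) (s : Fin (Λ.m i)) : Λ.Word := PresentedMonoid.of Λ.Rel ⟨i, s⟩

/-- The degree map as a monoid homomorphism. -/
def degHom : Λ.Word →* Multiplicative (Fin k → ℕ) :=
  PresentedMonoid.lift (fun g : Λ.Gen => Multiplicative.ofAdd (Pi.single g.1 1)) (by
    rintro _ _ ⟨h, s, s', t, t', -⟩
    simp [mul_comm])

/-- The degree `d(w) ∈ ℕ^k` of `w ∈ 𝔽_θ⁺`. -/
def d (w : Λ.Word) : Fin k → ℕ := Multiplicative.toAdd (Λ.degHom w)

/-- `Λ^min(μ, ν) = {(ξ, η) : μ ξ = ν η, d(μ ξ) = d(μ) ∨ d(ν)}`. -/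
def minExt (μ ν : Λ.Word) : Set (Λ.Word × Λ.Word) :=
  {p | μ * p.1 = ν * p.2 ∧ Λ.d (μ * p.1) = Λ.d μ ⊔ Λ.d ν}

/-- The little pull-back property: `|Λ^min(e, f)| ≤ 1` whenever `e`, `f` are edges of distinct
degrees. -/
def LittlePullback : Prop :=
  ∀ (i j : Fin k), i ≠ j → ∀ (s : Fin (Λ.m i)) (t : Fin (Λ.m j)),
    (Λ.minExt (Λ.e i s) (Λ.e j t)).encard ≤ 1

/-- A Cuntz-type representation of `𝔽_θ⁺` in a unital C⋆-algebra `A`. -/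
structure CuntzRep (A : Type*) [CStarAlgebra A] where
  /-- the operators `E^i_s` -/
  E : ∀ i : Fin k, Fin (Λ.m i) → A
  star_mul_self : ∀ i s, star (E i s) * E i s = 1
  star_mul_of_ne : ∀ i s t, s ≠ t → star (E i s) * E i t = 0
  sum_mul_star : ∀ i, ∑ s, E i s * star (E i s) = 1
  comm : ∀ ⦃i j : Fin k⦄ (h : i < j) (s s' : Fin (Λ.m i)) (t t' : Fin (Λ.m j)),
    Λ.θ h (s, t) = (s', t') → E i s * E j t = E j t' * E i s'

/-- The operators `E_w`, `w ∈ 𝔽_θ⁺`, of a Cuntz-type representation `E`. -/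
def CuntzRep.word {Λ : SingleVertexKGraph k} {A : Type*} [CStarAlgebra A] (E : Λ.CuntzRep A) :
    Λ.Word →* A :=
  PresentedMonoid.lift (fun g : Λ.Gen => E.E g.1 g.2) (by
    rintro _ _ ⟨h, s, s', t, t', hθ⟩
    simpa using E.comm h s s' t t' hθ)

/-- All Cuntz-type representations of `𝔽_θ⁺` in nonzero C⋆-algebras. Since the C⋆-algebra generated
by such a representation is separable, algebras in `Type` suffice for universality. -/
structure Model where
  /-- the C⋆-algebra -/
  carrier : Type
  [cstar : CStarAlgebra carrier]
  [nontriv : Nontrivial carrier]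
  /-- the Cuntz-type representation -/
  rep : Λ.CuntzRep carrier

instance (M : Λ.Model) : CStarAlgebra M.carrier := M.cstar

instance (M : Λ.Model) : Nontrivial M.carrier := M.nontriv

/-- The C⋆-algebra of bounded families over all Cuntz-type representations. -/
abbrev BigProd : Type 1 := lp (fun M : Λ.Model => M.carrier) ∞

instance : CStarAlgebra Λ.BigProd where

/-- The direct sum, over all Cuntz-type representations, of the operators `E^i_s`. -/
def bigGen (i : Fin k) (s : Fin (Λ.m i)) : Λ.BigProd :=
  ⟨fun M => M.rep.E i s, memℓp_infty ⟨1, by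
    rintro _ ⟨M, rfl⟩
    have h := CStarRing.norm_star_mul_self (x := M.rep.E i s)
    rw [M.rep.star_mul_self, CStarRing.norm_one] at h
    change ‖M.rep.E i s‖ ≤ 1
    nlinarith [norm_nonneg (M.rep.E i s)]⟩⟩

/-- The closed ⋆-subalgebra of `BigProd` underlying `𝒪_θ`. -/
def algSub : StarSubalgebra ℂ Λ.BigProd :=
  (StarAlgebra.adjoin ℂ {x | ∃ i s, x = Λ.bigGen i s}).topologicalClosure

/-- The `k`-graph C⋆-algebra `𝒪_θ`: the universal C⋆-algebra for Cuntz-type representations of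
`𝔽_θ⁺`, i.e. the C⋆-algebra generated by the direct sum of all of them. -/
def O : Type 1 := Λ.algSub

instance : CStarAlgebra Λ.O :=
  StarSubalgebra.cstarAlgebra Λ.algSub
    (h_closed := StarSubalgebra.isClosed_topologicalClosure _)

/-- The inclusion of `𝒪_θ` in the algebra of bounded families. -/
def toBig : Λ.O →⋆ₐ[ℂ] Λ.BigProd := Λ.algSub.subtype

theorem toBig_injective : Function.Injective Λ.toBig := Subtype.val_injective

/-- The generator `s^i_t` of `𝒪_θ`. -/
def gen (i : Fin k) (t : Fin (Λ.m i)) : Λ.O :=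
  (⟨Λ.bigGen i t, StarSubalgebra.le_topologicalClosure _
    (StarAlgebra.subset_adjoin ℂ _ ⟨i, t, rfl⟩)⟩ : Λ.algSub)

theorem toBig_gen (i : Fin k) (t : Fin (Λ.m i)) : Λ.toBig (Λ.gen i t) = Λ.bigGen i t := rfl

/-- The canonical Cuntz-type representation `s` of `𝔽_θ⁺` in `𝒪_θ`. -/
def univRep : Λ.CuntzRep Λ.O where
  E := Λ.gen
  star_mul_self i s := by
    apply Λ.toBig_injective
    rw [map_mul, map_star, map_one, toBig_gen]
    ext M
    exact M.rep.star_mul_self i s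
  star_mul_of_ne i s t h := by
    apply Λ.toBig_injective
    rw [map_mul, map_star, map_zero, toBig_gen, toBig_gen]
    ext M
    exact M.rep.star_mul_of_ne i s t h
  sum_mul_star i := by
    apply Λ.toBig_injective
    rw [map_sum, map_one]
    ext M
    rw [lp.coeFn_sum, Finset.sum_apply]
    exact M.rep.sum_mul_star i
  comm i j h s s' t t' hθ := by
    apply Λ.toBig_injective
    simp only [map_mul, toBig_gen]
    ext M
    exact M.rep.comm h s s' t t' hθ

/-- Evaluation of a bounded family at one representation. -/
def evalHom (M : Λ.Model) : Λ.BigProd →⋆ₐ[ℂ] M.carrier where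
  toFun x := x M
  map_one' := rfl
  map_mul' _ _ := rfl
  map_zero' := rfl
  map_add' _ _ := rfl
  commutes' _ := rfl
  map_star' _ := rfl

/-- The universal property of `𝒪_θ`. -/
theorem existsUnique_lift (A : Type) [CStarAlgebra A] (E : Λ.CuntzRep A) :
    ∃! φ : Λ.O →⋆ₐ[ℂ] A, ∀ i s, φ (Λ.univRep.E i s) = E.E i s := by
  refine existsUnique_of_exists_of_unique ?_ ?_
  · rcases subsingleton_or_nontrivial A with h | h
    · exact ⟨{ toFun := fun _ => 0
               map_one' := Subsingleton.elim _ _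
               map_mul' := fun _ _ => Subsingleton.elim _ _
               map_zero' := Subsingleton.elim _ _
               map_add' := fun _ _ => Subsingleton.elim _ _
               commutes' := fun _ => Subsingleton.elim _ _
               map_star' := fun _ => Subsingleton.elim _ _ }, fun _ _ => Subsingleton.elim _ _⟩
    · exact ⟨(Λ.evalHom ⟨A, E⟩).comp Λ.toBig, fun _ _ => rfl⟩
  · intro φ ψ hφ hψ
    have hc : ∀ χ : Λ.O →⋆ₐ[ℂ] A, Continuous χ := fun χ =>
      (NonUnitalStarAlgHom.instContinuousLinearMapClassComplex
        (F := Λ.O →⋆ₐ[ℂ] A)).map_continuous χ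
    refine StarAlgHom.ext_topologicalClosure (S := StarAlgebra.adjoin ℂ {x | ∃ i s, x = Λ.bigGen i s})
      (hc φ) (hc ψ) ?_
    refine StarAlgHom.ext_adjoin ?_
    rintro ⟨_, hx⟩ ⟨i, s, rfl⟩
    exact (hφ i s).trans (hψ i s).symm

/-- The elements `s_w ∈ 𝒪_θ`, `w ∈ 𝔽_θ⁺`. -/
def sw (w : Λ.Word) : Λ.O := Λ.univRep.word w

/-- `𝒳_n = span {s_u s_v^* : d(u) - d(v) = n}`, the algebraic part of the `n`-th spectral subspace
of the gauge action, `n ∈ ℤ^k`. -/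
def X (n : Fin k → ℤ) : Submodule ℂ Λ.O :=
  Submodule.span ℂ {x | ∃ u v : Λ.Word, (∀ i, (Λ.d u i : ℤ) - (Λ.d v i : ℤ) = n i) ∧
    x = Λ.sw u * star (Λ.sw v)}

/-- `𝒰(𝒳₀)`: the unitaries of `𝒪_θ` that lie in `𝒳₀`. -/
def unitaryX₀ : Set (unitary Λ.O) := {U | (U : Λ.O) ∈ Λ.X 0}

end SingleVertexKGraph

/-- `Ave(A, V)`: the averaging operators `a ↦ ∑ λ_i U_i a U_i^*` with `U_i ∈ V`, `λ_i > 0`,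
`∑ λ_i = 1`. -/
def Ave (A : Type*) [CStarAlgebra A] (V : Set (unitary A)) : Set (A → A) :=
  {α | ∃ (n : ℕ) (U : Fin n → unitary A) (c : Fin n → ℝ),
    (∀ i, U i ∈ V) ∧ (∀ i, 0 < c i) ∧ ∑ i, c i = 1 ∧
    ∀ a, α a = ∑ i, (c i : ℂ) • ((U i : A) * a * star (U i : A))}

end

/-!
For each colour `i` consider the average `Φ_i(A) = m_i⁻¹ ∑ s, (E^i_s)^* A E^i_s`. The
`θ`-relations make these maps commute, and they are contractions fixing the scalars, so the elements
which products of the `Φ_i` move arbitrarily close to `ℂ` form a closed subspace, as in the mean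
ergodic theorem. The little pull-back property says that `E^i_s E^j_t = E^j_{τ t} E^i_{σ t}` with
`τ` a permutation; hence `(E^j_t)^* E^i_s` has the form `E^i_{s'} (E^j_{t'})^*`, and the elements
`E_u E_v^*` span a dense subspace. If `u` and `v` both contain an edge of colour `i`, then `Φ_i`
cancels one from each. If only `u` does, then `Φ_i` maps `E_u E_v^*` to `m_i⁻¹ ≤ 1/2` times another
element of this form; the case of `v` follows by taking adjoints. So every `E_u E_v^*` belongs to
that subspace.

A product of the `Φ_i` is the average of the compressions `T_a^* A T_a` over isometries `T_a` of one
common degree whose range projections sum to `1`. Following it by the endomorphism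
`A ↦ ∑ a, T_a A T_a^*`, a contraction which fixes the scalars, gives the average of `U A U^*` over
a unitary 1-design in the matrix algebra with matrix units `T_a T_b^*`, and these unitaries lie in
the span of the `E_u E_v^*` with `d(u) = d(v)`. Since averages of `A` are bounded and `ℂ` is locally
compact, approximation of scalars yields a scalar in the closure.
-/

section Ave

variable {B : Type*} [CStarAlgebra B] {V : Set (unitary B)}

theorem inv_card_smul_sum_conj_mem_Ave {κ : Type*} [Fintype κ] [Nonempty κ] (U : κ → unitary B)
    (hU : ∀ x, U x ∈ V) :
    (fun A => (Fintype.card κ : ℂ)⁻¹ • ∑ x, (U x : B) * A * star (U x : B)) ∈ Ave B V := by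
  let e := (Fintype.equivFin κ).symm
  refine ⟨Fintype.card κ, U ∘ e, fun _ => (Fintype.card κ : ℝ)⁻¹, fun _ => hU _,
    fun _ => by positivity, by simp, fun A => ?_⟩
  simp only [Function.comp_apply, Complex.ofReal_inv, Complex.ofReal_natCast, ← Finset.smul_sum]
  rw [e.sum_comp fun x => (U x : B) * A * star (U x : B)]

theorem norm_apply_le_of_mem_Ave {α : B → B} (hα : α ∈ Ave B V) (A : B) : ‖α A‖ ≤ ‖A‖ := by
  obtain ⟨n, U, c, -, hc, hsum, h⟩ := hα
  calc ‖α A‖ ≤ ∑ i, c i * ‖A‖ := by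
        rw [h]
        refine norm_sum_le_of_le _ fun i _ => ?_
        rw [norm_smul, Complex.norm_real, Real.norm_of_nonneg (hc i).le, ← Unitary.coe_star,
          CStarRing.norm_mul_coe_unitary, CStarRing.norm_coe_unitary_mul]
    _ = ‖A‖ := by rw [← Finset.sum_mul, hsum, one_mul]

end Ave

theorem closure_inter_nonempty_of_forall_exists_norm_sub_lt {𝕜 E : Type*}
    [NontriviallyNormedField 𝕜] [LocallyCompactSpace 𝕜] [NormedAddCommGroup E] [NormedSpace 𝕜 E]
    {S : Set E} (hS : Bornology.IsBounded S) (F : Submodule 𝕜 E) [FiniteDimensional 𝕜 F]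
    (h : ∀ ε > 0, ∃ x ∈ S, ∃ y ∈ F, ‖x - y‖ < ε) : (closure S ∩ F).Nonempty := by
  obtain ⟨R, hR⟩ := hS.exists_norm_le
  have : ProperSpace F := FiniteDimensional.proper 𝕜 F
  let K : Set E := (↑) '' Metric.closedBall (0 : F) (R + 1)
  have hK : IsCompact K := (isCompact_closedBall _ _).image continuous_subtype_val
  by_contra hempty
  have hdisj : Disjoint K (closure S) := by
    refine Set.disjoint_left.2 ?_
    rintro _ ⟨y, -, rfl⟩ hy
    exact hempty ⟨y, hy, y.2⟩
  obtain ⟨δ, hδ, hthick⟩ := hdisj.exists_thickenings hK isClosed_closure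
  obtain ⟨x, hx, y, hy, hxy⟩ := h (min δ 1) (lt_min hδ one_pos)
  have hyK : y ∈ K := by
    refine ⟨⟨y, hy⟩, mem_closedBall_zero_iff.2 ?_, rfl⟩
    calc ‖y‖ ≤ ‖x‖ + ‖x - y‖ := norm_le_norm_add_norm_sub x y
      _ ≤ R + 1 := add_le_add (hR x hx) (hxy.le.trans (min_le_right δ 1))
  have hxK : x ∈ Metric.thickening δ K :=
    Metric.mem_thickening_iff.2
      ⟨y, hyK, (dist_eq_norm x y).trans_lt (hxy.trans_le (min_le_left δ 1))⟩
  exact Set.disjoint_left.1 hthick hxK (Metric.self_subset_thickening hδ _ (subset_closure hx))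

section Contractions

variable {𝕜 E : Type*} [NormedField 𝕜] [SeminormedAddCommGroup E] [NormedSpace 𝕜 E]

/-- A commutative monoid of linear contractions of a normed space which fixes the subspace `F`
pointwise, as in the mean ergodic theorem. -/
structure IsCommContractive (S : Submonoid (Module.End 𝕜 E)) (F : Submodule 𝕜 E) : Prop where
  commute : ∀ φ ∈ S, ∀ ψ ∈ S, Commute φ ψ
  norm_apply_le : ∀ φ ∈ S, ∀ x, ‖φ x‖ ≤ ‖x‖
  apply_eq_self : ∀ φ ∈ S, ∀ x ∈ F, φ x = x

namespace IsCommContractive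

variable {S : Submonoid (Module.End 𝕜 E)} {F : Submodule 𝕜 E}

theorem closure {s : Set (Module.End 𝕜 E)} (commute : ∀ φ ∈ s, ∀ ψ ∈ s, Commute φ ψ)
    (norm_apply_le : ∀ φ ∈ s, ∀ x, ‖φ x‖ ≤ ‖x‖) (apply_eq_self : ∀ φ ∈ s, ∀ x ∈ F, φ x = x) :
    IsCommContractive (Submonoid.closure s) F where
  commute φ hφ ψ hψ := by
    induction hφ, hψ using Submonoid.closure_induction₂ with
    | mem φ ψ hφ hψ => exact commute φ hφ ψ hψ
    | one_left φ _ => exact .one_left φ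
    | one_right φ _ => exact .one_right φ
    | mul_left _ _ _ _ _ _ h₁ h₂ => exact h₁.mul_left h₂
    | mul_right _ _ _ _ _ _ h₁ h₂ => exact h₁.mul_right h₂
  norm_apply_le φ hφ := by
    induction hφ using Submonoid.closure_induction with
    | mem φ hφ => exact norm_apply_le φ hφ
    | one => exact fun _ => le_rfl
    | mul φ ψ _ _ h₁ h₂ => exact fun x => (h₁ (ψ x)).trans (h₂ x)
  apply_eq_self φ hφ := by
    induction hφ using Submonoid.closure_induction with
    | mem φ hφ => exact apply_eq_self φ hφ
    | one => exact fun _ _ => rfl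
    | mul φ ψ _ _ h₁ h₂ =>
      exact fun x hx => by rw [Module.End.mul_apply, h₂ x hx, h₁ x hx]

theorem norm_apply_sub_le (hS : IsCommContractive S F) {φ : Module.End 𝕜 E} (hφ : φ ∈ S) (x : E)
    {c : E} (hc : c ∈ F) : ‖φ x - c‖ ≤ ‖x - c‖ := by
  simpa only [map_sub, hS.apply_eq_self φ hφ c hc] using hS.norm_apply_le φ hφ (x - c)

/-- The subspace of all vectors which the maps in `S` move arbitrarily close to `F`. -/
def attracted (hS : IsCommContractive S F) : Submodule 𝕜 E where
  carrier := {x | ∀ ε > 0, ∃ φ ∈ S, ∃ c ∈ F, ‖φ x - c‖ < ε}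
  zero_mem' ε hε := ⟨1, one_mem S, 0, zero_mem F, by simpa using hε⟩
  add_mem' {x y} hx hy ε hε := by
    obtain ⟨φ, hφ, c, hc, hxc⟩ := hx (ε / 2) (half_pos hε)
    obtain ⟨ψ, hψ, d, hd, hyd⟩ := hy (ε / 2) (half_pos hε)
    have hx' : ‖φ (ψ x) - c‖ ≤ ‖φ x - c‖ := by
      rw [← Module.End.mul_apply, (hS.commute φ hφ ψ hψ).eq]
      exact hS.norm_apply_sub_le hψ (φ x) hc
    have hy' : ‖φ (ψ y) - d‖ ≤ ‖ψ y - d‖ := hS.norm_apply_sub_le hφ (ψ y) hd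
    refine ⟨φ * ψ, mul_mem hφ hψ, c + d, add_mem hc hd, ?_⟩
    calc ‖(φ * ψ) (x + y) - (c + d)‖ = ‖(φ (ψ x) - c) + (φ (ψ y) - d)‖ := by
          rw [Module.End.mul_apply, map_add, map_add, add_sub_add_comm]
      _ ≤ ‖φ (ψ x) - c‖ + ‖φ (ψ y) - d‖ := norm_add_le _ _
      _ < ε := by linarith
  smul_mem' z x hx ε hε := by
    obtain ⟨φ, hφ, c, hc, hxc⟩ := hx (ε / (‖z‖ + 1)) (by positivity)
    refine ⟨φ, hφ, z • c, F.smul_mem z hc, ?_⟩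
    rw [lt_div_iff₀ (by positivity)] at hxc
    rw [map_smul, ← smul_sub, norm_smul]
    nlinarith [norm_nonneg (φ x - c)]

theorem le_attracted (hS : IsCommContractive S F) : F ≤ hS.attracted :=
  fun x hx ε hε => ⟨1, one_mem S, x, hx, by simpa using hε⟩

theorem mem_attracted_of_apply_mem (hS : IsCommContractive S F) {φ : Module.End 𝕜 E} (hφ : φ ∈ S)
    {x : E} (hx : φ x ∈ hS.attracted) : x ∈ hS.attracted := fun ε hε => by
  obtain ⟨ψ, hψ, c, hc, h⟩ := hx ε hε
  exact ⟨ψ * φ, mul_mem hψ hφ, c, hc, h⟩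

theorem isClosed_attracted (hS : IsCommContractive S F) : IsClosed (hS.attracted : Set E) := by
  refine isClosed_of_closure_subset fun x hx ε hε => ?_
  obtain ⟨y, hy, hxy⟩ := Metric.mem_closure_iff.1 hx (ε / 2) (half_pos hε)
  obtain ⟨φ, hφ, c, hc, hyc⟩ := hy (ε / 2) (half_pos hε)
  refine ⟨φ, hφ, c, hc, ?_⟩
  calc ‖φ x - c‖ = ‖φ (x - y) + (φ y - c)‖ := by rw [map_sub, sub_add_sub_cancel]
    _ ≤ ‖φ (x - y)‖ + ‖φ y - c‖ := norm_add_le _ _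
    _ < ε := by
      have := hS.norm_apply_le φ hφ (x - y)
      rw [← dist_eq_norm x y] at this
      linarith

end IsCommContractive

end Contractions

section UnitaryDesign

open Matrix

universe u

/-- A finite family of unitary matrices is a unitary 1-design if averaging `W X W^*` over it gives
the normalized trace of `X`; this is stated on matrix entries, as a Schur orthogonality relation. -/
def IsUnitaryOneDesign {ι κ : Type*} [Fintype ι] [DecidableEq ι] [Fintype κ]
    (W : κ → unitaryGroup ι ℂ) : Prop :=
  ∀ a b c d, (Fintype.card κ : ℂ)⁻¹ * ∑ x, W x a b * star (W x c d) =
    if a = c ∧ b = d then (Fintype.card ι : ℂ)⁻¹ else 0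

variable {ι : Type*} [Fintype ι] [DecidableEq ι]

theorem sum_sign_mul_sign (a b : ι) :
    ∑ ε : ι → ℤˣ, (ε a : ℤ) * (ε b : ℤ) = if a = b then 2 ^ Fintype.card ι else 0 := by
  split_ifs with h
  · subst h
    have hsq (ε : ι → ℤˣ) : (ε a : ℤ) * (ε a : ℤ) = 1 := by
      rw [← Units.val_mul, Int.units_mul_self, Units.val_one]
    simp [hsq]
  · have hflip := Equiv.sum_comp (Equiv.mulLeft (Pi.mulSingle a (-1) : ι → ℤˣ))
      fun ε : ι → ℤˣ => (ε a : ℤ) * (ε b : ℤ)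
    simp only [Equiv.coe_mulLeft, Pi.mul_apply, Pi.mulSingle_eq_same,
      Pi.mulSingle_eq_of_ne (Ne.symm h), one_mul, Units.val_neg, neg_mul,
      Finset.sum_neg_distrib] at hflip
    linarith

/-- The monomial matrix that sends the basis vector `b` to `ε b` times the basis vector `b + j`,
where `p = (j, ε)`; signs replace the roots of unity of the Weyl-Heisenberg matrices. -/
def signedShift [AddGroup ι] (p : ι × (ι → ℤˣ)) : unitaryGroup ι ℂ :=
  ⟨of fun a b => if a = b + p.1 then ((p.2 b : ℤ) : ℂ) else 0, by
    have hsq (b : ι) : ((p.2 b : ℤ) : ℂ) * (p.2 b : ℤ) = 1 := by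
      rw [← Int.cast_mul, ← Units.val_mul, Int.units_mul_self, Units.val_one, Int.cast_one]
    rw [mem_unitaryGroup_iff']
    ext a b
    simp only [mul_apply, star_apply, of_apply, ite_mul, zero_mul, mul_ite, mul_zero,
      apply_ite star, star_zero, Finset.sum_ite_eq', Finset.mem_univ, if_true, one_apply,
      add_left_inj]
    by_cases h : a = b
    · simp [h, hsq]
    · simp [h, Ne.symm h]⟩

theorem signedShift_apply [AddGroup ι] (p : ι × (ι → ℤˣ)) (a b : ι) :
    signedShift p a b = if a = b + p.1 then ((p.2 b : ℤ) : ℂ) else 0 :=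
  rfl

theorem isUnitaryOneDesign_signedShift [AddGroup ι] :
    IsUnitaryOneDesign (signedShift : ι × (ι → ℤˣ) → unitaryGroup ι ℂ) := by
  intro a b c d
  have hsign : ∑ ε : ι → ℤˣ, ((ε b : ℤ) : ℂ) * (ε d : ℤ) =
      if b = d then 2 ^ Fintype.card ι else 0 := by
    exact_mod_cast congrArg (Int.cast : ℤ → ℂ) (sum_sign_mul_sign b d)
  have hshift (j : ι) : a = b + j ↔ j = -b + a := by rw [eq_neg_add_iff_add_eq, eq_comm]
  have hentry (p : ι × (ι → ℤˣ)) : signedShift p a b * star (signedShift p c d) =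
      (if p.1 = -b + a then if c = d + p.1 then 1 else 0 else 0) *
        (((p.2 b : ℤ) : ℂ) * (p.2 d : ℤ)) := by
    simp only [signedShift_apply, hshift]
    split_ifs <;> simp
  have hsum : ∑ p, signedShift p a b * star (signedShift p c d) =
      if a = c ∧ b = d then 2 ^ Fintype.card ι else 0 := by
    calc ∑ p, signedShift p a b * star (signedShift p c d)
        = (∑ j, if j = -b + a then if c = d + j then 1 else 0 else 0) *
            ∑ ε : ι → ℤˣ, ((ε b : ℤ) : ℂ) * (ε d : ℤ) := by
          rw [Finset.sum_mul_sum, ← Fintype.sum_prod_type']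
          exact Finset.sum_congr rfl fun p _ => hentry p
      _ = if a = c ∧ b = d then 2 ^ Fintype.card ι else 0 := by
          rw [hsign, Finset.sum_ite_eq' Finset.univ, if_pos (Finset.mem_univ _)]
          by_cases hbd : b = d
          · simp [hbd, eq_comm]
          · simp [hbd]
  rw [hsum, Fintype.card_prod, Fintype.card_pi]
  split_ifs <;> simp [mul_right_comm _ _ ((2 : ℂ) ^ _)]

theorem exists_isUnitaryOneDesign (ι : Type u) [Fintype ι] [DecidableEq ι] [Nonempty ι] :
    ∃ (κ : Type u) (_ : Fintype κ) (_ : Nonempty κ) (W : κ → unitaryGroup ι ℂ),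
      IsUnitaryOneDesign W := by
  have : NeZero (Fintype.card ι) := ⟨Fintype.card_ne_zero⟩
  let : AddGroup ι := (Fintype.equivFin ι).addGroup
  exact ⟨ι × (ι → ℤˣ), inferInstance, inferInstance, _, isUnitaryOneDesign_signedShift⟩

end UnitaryDesign

section CompressionMean

variable {B : Type*} [Ring B] [StarRing B] [Algebra ℂ B]

/-- The average `|ι|⁻¹ ∑ a, T_a^* A T_a` of the compressions of `A` by a finite family `T`. -/
noncomputable def compressionMean {ι : Type*} [Fintype ι] (T : ι → B) : Module.End ℂ B where
  toFun A := (Fintype.card ι : ℂ)⁻¹ • ∑ a, star (T a) * A * T a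
  map_add' x y := by simp only [mul_add, add_mul, Finset.sum_add_distrib, smul_add]
  map_smul' c x := by
    simp only [mul_smul_comm, smul_mul_assoc, RingHom.id_apply, ← Finset.smul_sum]
    rw [smul_comm]

variable {ι κ : Type*} [Fintype ι] [Fintype κ]

theorem compressionMean_apply (T : ι → B) (A : B) :
    compressionMean T A = (Fintype.card ι : ℂ)⁻¹ • ∑ a, star (T a) * A * T a :=
  rfl

theorem star_compressionMean [StarModule ℂ B] (T : ι → B) (A : B) :
    star (compressionMean T A) = compressionMean T (star A) := by
  simp [compressionMean_apply, mul_assoc]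

theorem compressionMean_comp_equiv (T : ι → B) (e : κ ≃ ι) :
    compressionMean (T ∘ e) = compressionMean T := by
  ext A
  rw [compressionMean_apply, compressionMean_apply, Fintype.card_congr e,
    ← e.sum_comp fun a => star (T a) * A * T a]
  rfl

theorem compressionMean_mul_compressionMean (T : ι → B) (S : κ → B) :
    compressionMean S * compressionMean T =
      compressionMean fun p : ι × κ => T p.1 * S p.2 := by
  ext A
  simp only [Module.End.mul_apply, compressionMean_apply, mul_smul_comm, smul_mul_assoc,
    ← Finset.smul_sum, smul_smul, Fintype.card_prod, Nat.cast_mul, mul_inv,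
    Fintype.sum_prod_type, Finset.mul_sum, Finset.sum_mul, star_mul, mul_assoc]
  rw [mul_comm, Finset.sum_comm]

end CompressionMean

theorem norm_le_one_of_star_mul_self_eq_one {B : Type*} [NormedRing B] [StarRing B]
    [CStarRing B] {v : B} (hv : star v * v = 1) : ‖v‖ ≤ 1 := by
  have hone : ‖(1 : B)‖ ≤ 1 := by
    have := CStarRing.norm_star_mul_self (x := (1 : B))
    rw [star_one, one_mul] at this
    nlinarith [norm_nonneg (1 : B)]
  have := CStarRing.norm_star_mul_self (x := v)
  rw [hv] at this
  nlinarith [norm_nonneg v]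

/-- A finite family of isometries whose range projections sum to `1`, i.e. a representation of
the Cuntz relations. -/
structure IsCuntzFamily {B ι : Type*} [Ring B] [StarRing B] [Fintype ι] (T : ι → B) :
    Prop where
  star_mul_self : ∀ a, star (T a) * T a = 1
  star_mul_of_ne : ∀ a b, a ≠ b → star (T a) * T b = 0
  sum_mul_star : ∑ a, T a * star (T a) = 1

namespace IsCuntzFamily

section Algebraic

variable {B ι κ : Type*} [Ring B] [StarRing B] [Fintype ι] [Fintype κ] {T : ι → B}

theorem star_mul_eq_ite [DecidableEq ι] (hT : IsCuntzFamily T) (a b : ι) :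
    star (T a) * T b = if a = b then 1 else 0 := by
  split_ifs with h
  · rw [h, hT.star_mul_self]
  · exact hT.star_mul_of_ne a b h

theorem subsingleton_of_isEmpty [IsEmpty ι] (hT : IsCuntzFamily T) : Subsingleton B :=
  subsingleton_of_zero_eq_one (by simpa using hT.sum_mul_star)

theorem mul (hT : IsCuntzFamily T) {S : κ → B} (hS : IsCuntzFamily S) :
    IsCuntzFamily fun p : ι × κ => T p.1 * S p.2 where
  star_mul_self p := by
    rw [star_mul, mul_assoc, ← mul_assoc (star (T _)), hT.star_mul_self, one_mul, hS.star_mul_self]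
  star_mul_of_ne := by
    classical
    rintro ⟨a, c⟩ ⟨b, d⟩ hne
    rw [star_mul, mul_assoc, ← mul_assoc (star (T _)), hT.star_mul_eq_ite]
    split_ifs with hab
    · rw [one_mul]
      exact hS.star_mul_of_ne c d fun hcd => hne (Prod.ext hab hcd)
    · simp
  sum_mul_star := by
    calc ∑ p : ι × κ, T p.1 * S p.2 * star (T p.1 * S p.2)
        = ∑ a, T a * (∑ c, S c * star (S c)) * star (T a) := by
          simp only [Fintype.sum_prod_type, star_mul, Finset.mul_sum, Finset.sum_mul, mul_assoc]
      _ = 1 := by simp only [hS.sum_mul_star, mul_one, hT.sum_mul_star]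

variable [Algebra ℂ B]

theorem compressionMean_one (hT : IsCuntzFamily T) : compressionMean T 1 = 1 := by
  rcases isEmpty_or_nonempty ι with _ | _
  · have := hT.subsingleton_of_isEmpty
    exact Subsingleton.elim _ _
  · simp [compressionMean_apply, hT.star_mul_self, ← Nat.cast_smul_eq_nsmul ℂ, smul_smul]

/-- The endomorphism `A ↦ ∑ a, T_a A T_a^*` defined by a Cuntz family. -/
noncomputable def dilation (hT : IsCuntzFamily T) : B →⋆ₐ[ℂ] B where
  toFun A := ∑ a, T a * A * star (T a)
  map_one' := by simp only [mul_one, hT.sum_mul_star]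
  map_mul' x y := by
    classical
    have hmul (a b : ι) : T a * x * star (T a) * (T b * y * star (T b)) =
        if a = b then T a * (x * y) * star (T b) else 0 := by
      calc T a * x * star (T a) * (T b * y * star (T b))
          = T a * x * (star (T a) * T b) * y * star (T b) := by simp only [mul_assoc]
        _ = _ := by rw [hT.star_mul_eq_ite]; split_ifs <;> simp [mul_assoc]
    simp only [Finset.sum_mul_sum, hmul, Finset.sum_ite_eq, Finset.mem_univ, if_true]
  map_zero' := by simp
  map_add' x y := by simp only [mul_add, add_mul, Finset.sum_add_distrib]
  commutes' c := by
    simp only [Algebra.algebraMap_eq_smul_one, mul_smul_comm, mul_one, smul_mul_assoc,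
      ← Finset.smul_sum, hT.sum_mul_star]
  map_star' x := by simp [mul_assoc]

theorem dilation_apply (hT : IsCuntzFamily T) (A : B) :
    hT.dilation A = ∑ a, T a * A * star (T a) :=
  rfl

variable [StarModule ℂ B]

/-- The representation of the matrix algebra by the matrix units `T_a T_b^*` of a Cuntz family. -/
noncomputable def matrixHom [DecidableEq ι] (hT : IsCuntzFamily T) : Matrix ι ι ℂ →⋆ₐ[ℂ] B where
  toFun M := ∑ a, ∑ b, M a b • (T a * star (T b))
  map_one' := by simp [Matrix.one_apply, hT.sum_mul_star]
  map_mul' M N := by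
    have hunit (a b c d : ι) : T a * star (T b) * (T c * star (T d)) =
        if b = c then T a * star (T d) else 0 := by
      rw [mul_assoc, ← mul_assoc (star (T b)), hT.star_mul_eq_ite]
      split_ifs <;> simp
    simp only [Finset.sum_mul_sum, smul_mul_smul_comm, hunit, smul_ite, smul_zero,
      Matrix.mul_apply, Finset.sum_smul]
    refine Finset.sum_congr rfl fun a _ => ?_
    conv_lhs => rw [Finset.sum_comm]
    refine Finset.sum_congr rfl fun c _ => ?_
    rw [Finset.sum_comm]
    simp only [Finset.sum_ite_eq', Finset.mem_univ, if_true]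
  map_zero' := by simp
  map_add' M N := by simp only [Matrix.add_apply, add_smul, Finset.sum_add_distrib]
  commutes' c := by
    simp [Matrix.algebraMap_matrix_apply, Algebra.algebraMap_eq_smul_one, ← Finset.smul_sum,
      hT.sum_mul_star]
  map_star' M := by
    simp only [Matrix.star_apply, star_sum, star_smul, star_mul, star_star]
    exact Finset.sum_comm

theorem matrixHom_apply [DecidableEq ι] (hT : IsCuntzFamily T) (M : Matrix ι ι ℂ) :
    hT.matrixHom M = ∑ p : ι × ι, M p.1 p.2 • (T p.1 * star (T p.2)) :=
  (Fintype.sum_prod_type' fun a b => M a b • (T a * star (T b))).symm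

theorem matrixHom_mem_span [DecidableEq ι] (hT : IsCuntzFamily T) (M : Matrix ι ι ℂ) :
    hT.matrixHom M ∈ Submodule.span ℂ {x | ∃ a b, x = T a * star (T b)} := by
  rw [matrixHom_apply]
  exact Submodule.sum_mem _ fun p _ =>
    Submodule.smul_mem _ _ (Submodule.subset_span ⟨p.1, p.2, rfl⟩)

theorem inv_card_smul_sum_matrixHom_conj [DecidableEq ι] (hT : IsCuntzFamily T)
    {W : κ → Matrix.unitaryGroup ι ℂ} (hW : IsUnitaryOneDesign W) (A : B) :
    (Fintype.card κ : ℂ)⁻¹ • ∑ x, hT.matrixHom (W x) * A * star (hT.matrixHom (W x)) =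
      hT.dilation (compressionMean T A) := by
  have hconj (x : κ) : hT.matrixHom (W x) * A * star (hT.matrixHom (W x)) =
      ∑ p : ι × ι, ∑ q : ι × ι, (W x p.1 p.2 * star (W x q.1 q.2)) •
        (T p.1 * (star (T p.2) * A * T q.2) * star (T q.1)) := by
    simp only [matrixHom_apply, star_sum, star_smul, star_mul, star_star]
    rw [Finset.sum_mul, Finset.sum_mul_sum]
    refine Finset.sum_congr rfl fun p _ => Finset.sum_congr rfl fun q _ => ?_
    rw [smul_mul_assoc, smul_mul_smul_comm]
    simp only [mul_assoc]
  calc (Fintype.card κ : ℂ)⁻¹ • ∑ x, hT.matrixHom (W x) * A * star (hT.matrixHom (W x))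
      = ∑ p : ι × ι, ∑ q : ι × ι,
          ((Fintype.card κ : ℂ)⁻¹ * ∑ x, W x p.1 p.2 * star (W x q.1 q.2)) •
            (T p.1 * (star (T p.2) * A * T q.2) * star (T q.1)) := by
        simp only [hconj, mul_smul (Fintype.card κ : ℂ)⁻¹, Finset.sum_smul, ← Finset.smul_sum]
        rw [Finset.sum_comm]
        exact congrArg _ (Finset.sum_congr rfl fun p _ => Finset.sum_comm)
    _ = ∑ p : ι × ι, (Fintype.card ι : ℂ)⁻¹ •
          (T p.1 * (star (T p.2) * A * T p.2) * star (T p.1)) := by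
        simp only [hW _ _ _ _, ← Prod.ext_iff, ite_smul, zero_smul, Finset.sum_ite_eq,
          Finset.mem_univ, if_true]
    _ = hT.dilation (compressionMean T A) := by
        simp only [Fintype.sum_prod_type, dilation_apply, compressionMean_apply, mul_smul_comm,
          smul_mul_assoc, Finset.mul_sum, Finset.sum_mul, Finset.smul_sum]

end Algebraic

section CStarAlgebra

variable {B ι : Type*} [CStarAlgebra B] [Fintype ι] {T : ι → B}

theorem norm_compressionMean_le (hT : IsCuntzFamily T) (A : B) :
    ‖compressionMean T A‖ ≤ ‖A‖ := by
  have hterm (a : ι) : ‖star (T a) * A * T a‖ ≤ ‖A‖ := by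
    have hnorm := norm_le_one_of_star_mul_self_eq_one (hT.star_mul_self a)
    calc ‖star (T a) * A * T a‖ ≤ ‖star (T a)‖ * ‖A‖ * ‖T a‖ := norm_mul₃_le
      _ ≤ 1 * ‖A‖ * 1 := by rw [norm_star]; gcongr
      _ = ‖A‖ := by rw [one_mul, mul_one]
  calc ‖compressionMean T A‖ ≤ (Fintype.card ι : ℝ)⁻¹ * ∑ _a : ι, ‖A‖ := by
        rw [compressionMean_apply, norm_smul, norm_inv, Complex.norm_natCast]
        gcongr
        exact norm_sum_le_of_le _ fun a _ => hterm a
    _ = ((Fintype.card ι : ℝ)⁻¹ * Fintype.card ι) * ‖A‖ := by simp [mul_assoc]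
    _ ≤ ‖A‖ := mul_le_of_le_one_left (norm_nonneg A) inv_mul_le_one

theorem dilation_compressionMean_mem_Ave (hT : IsCuntzFamily T) {V : Set (unitary B)}
    (hV : ∀ U : unitary B, (U : B) ∈ Submodule.span ℂ {x | ∃ a b, x = T a * star (T b)} → U ∈ V) :
    (fun A => hT.dilation (compressionMean T A)) ∈ Ave B V := by
  classical
  rcases isEmpty_or_nonempty ι with _ | _
  · have := hT.subsingleton_of_isEmpty
    have hone : ((1 : unitary B) : B) ∈ Submodule.span ℂ {x | ∃ a b, x = T a * star (T b)} := by
      rw [Subsingleton.elim ((1 : unitary B) : B) 0]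
      exact zero_mem _
    exact ⟨1, 1, 1, fun _ => hV 1 hone, by simp, by simp, fun _ => Subsingleton.elim _ _⟩
  · obtain ⟨κ, _, _, W, hW⟩ := exists_isUnitaryOneDesign ι
    simp only [← hT.inv_card_smul_sum_matrixHom_conj hW]
    exact inv_card_smul_sum_conj_mem_Ave
      (fun x => ⟨hT.matrixHom (W x), Unitary.map_mem hT.matrixHom (W x).2⟩)
      fun x => hV _ (hT.matrixHom_mem_span (W x))

end CStarAlgebra

end IsCuntzFamily

namespace SingleVertexKGraph

variable {k : ℕ} {Λ : SingleVertexKGraph k}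

@[simp]
theorem d_one : Λ.d 1 = 0 := by
  simp [d]

@[simp]
theorem d_mul (u v : Λ.Word) : Λ.d (u * v) = Λ.d u + Λ.d v := by
  simp [d]

@[simp]
theorem d_e (i : Fin k) (s : Fin (Λ.m i)) : Λ.d (Λ.e i s) = Pi.single i 1 := by
  simp [d, e, degHom, PresentedMonoid.lift_of]

theorem word_induction {p : Λ.Word → Prop} (one : p 1)
    (e_mul : ∀ i s w, p w → p (Λ.e i s * w)) (w : Λ.Word) : p w := by
  induction w using PresentedMonoid.inductionOn with
  | h a =>
    induction a using FreeMonoid.inductionOn' with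
    | one => rw [map_one]; exact one
    | of_mul g a ih => rw [map_mul]; exact e_mul g.1 g.2 _ ih

theorem e_mul_e_of_lt {i j : Fin k} (h : i < j) (s : Fin (Λ.m i)) (t : Fin (Λ.m j)) :
    Λ.e i s * Λ.e j t = Λ.e j (Λ.θ h (s, t)).2 * Λ.e i (Λ.θ h (s, t)).1 :=
  PresentedMonoid.mk_eq_mk_of_rel (.comm h s _ t _ rfl)

theorem exists_e_mul_e {i j : Fin k} (h : i ≠ j) (s : Fin (Λ.m i)) (t : Fin (Λ.m j)) :
    ∃ t' s', Λ.e i s * Λ.e j t = Λ.e j t' * Λ.e i s' := by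
  rcases lt_or_gt_of_ne h with hij | hji
  · exact ⟨_, _, e_mul_e_of_lt hij s t⟩
  · obtain ⟨⟨t', s'⟩, hθ⟩ := (Λ.θ hji).surjective (t, s)
    exact ⟨t', s', by rw [e_mul_e_of_lt hji, hθ]⟩

theorem e_injective (i : Fin k) : Function.Injective (Λ.e i) := by
  -- Both sides of a relation have length two, so they vanish in a square-zero extension.
  let f : Λ.Word →* TrivSqZeroExt ℤ (Λ.Gen → ℤ) :=
    PresentedMonoid.lift (fun g => TrivSqZeroExt.inr (Pi.single g 1)) (by
      rintro _ _ ⟨⟩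
      simp)
  intro s t hst
  have hsingle : (Pi.single ⟨i, s⟩ 1 : Λ.Gen → ℤ) = Pi.single ⟨i, t⟩ 1 :=
    TrivSqZeroExt.inr_injective (congrArg f hst)
  simpa [Pi.single_apply] using congrFun hsingle ⟨i, s⟩

theorem exists_eq_e_mul (i : Fin k) (w : Λ.Word) (h : Λ.d w i ≠ 0) :
    ∃ a w', w = Λ.e i a * w' := by
  induction w using word_induction with
  | one => simp at h
  | e_mul j b w ih =>
    obtain rfl | hij := eq_or_ne i j
    · exact ⟨b, w, rfl⟩
    · obtain ⟨a, w', rfl⟩ := ih (by simpa [Pi.single_apply, hij] using h)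
      obtain ⟨a', b', h'⟩ := exists_e_mul_e hij.symm b a
      exact ⟨a', Λ.e j b' * w', by rw [← mul_assoc, h', mul_assoc]⟩

theorem LittlePullback.exists_perm_e_mul_e (hΛ : Λ.LittlePullback) {i j : Fin k} (h : i ≠ j)
    (s : Fin (Λ.m i)) : ∃ (τ : Equiv.Perm (Fin (Λ.m j))) (σ : Fin (Λ.m j) → Fin (Λ.m i)),
      ∀ t, Λ.e i s * Λ.e j t = Λ.e j (τ t) * Λ.e i (σ t) := by
  choose τ σ hτ using exists_e_mul_e (Λ := Λ) h s
  have hmem (t : Fin (Λ.m j)) :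
      (Λ.e j t, Λ.e i (σ t)) ∈ Λ.minExt (Λ.e i s) (Λ.e j (τ t)) := by
    refine ⟨hτ t, ?_⟩
    ext l
    by_cases hi : l = i
    · subst hi; simp [h]
    · by_cases hj : l = j
      · subst hj; simp [hi]
      · simp [hi, hj]
  have hinj : Function.Injective τ := fun t t' ht =>
    e_injective j (congrArg Prod.fst
      (Set.encard_le_one_iff.1 (hΛ i j h s (τ t)) _ _ (hmem t) (ht ▸ hmem t')))
  exact ⟨Equiv.ofBijective τ (Finite.injective_iff_bijective.1 hinj), σ, hτ⟩

variable {B : Type*} [CStarAlgebra B]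

section WordSpan

variable (E : Λ.CuntzRep B)

@[simp]
theorem CuntzRep.word_e (i : Fin k) (s : Fin (Λ.m i)) : E.word (Λ.e i s) = E.E i s :=
  rfl

theorem CuntzRep.isCuntzFamily (i : Fin k) : IsCuntzFamily (E.E i) :=
  ⟨E.star_mul_self i, E.star_mul_of_ne i, E.sum_mul_star i⟩

theorem CuntzRep.star_word_mul_word_self (w : Λ.Word) : star (E.word w) * E.word w = 1 := by
  induction w using word_induction with
  | one => simp
  | e_mul i s w ih =>
    rw [map_mul, word_e, star_mul, mul_assoc, ← mul_assoc (star (E.E i s)), E.star_mul_self,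
      one_mul, ih]

theorem LittlePullback.star_E_mul_E (hΛ : Λ.LittlePullback) {i j : Fin k} (h : i ≠ j)
    (s : Fin (Λ.m i)) (t : Fin (Λ.m j)) :
    ∃ s' t', star (E.E j t) * E.E i s = E.E i s' * star (E.E j t') := by
  obtain ⟨τ, σ, hτ⟩ := hΛ.exists_perm_e_mul_e h s
  obtain ⟨t₀, rfl⟩ := τ.surjective t
  have hE (t : Fin (Λ.m j)) : E.E i s * E.E j t = E.E j (τ t) * E.E i (σ t) := by
    simpa using congrArg E.word (hτ t)
  refine ⟨σ t₀, t₀, ?_⟩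
  calc star (E.E j (τ t₀)) * E.E i s
      = star (E.E j (τ t₀)) * E.E i s * ∑ t, E.E j t * star (E.E j t) := by
        rw [E.sum_mul_star, mul_one]
    _ = ∑ t, star (E.E j (τ t₀)) * (E.E i s * E.E j t) * star (E.E j t) := by
        simp only [Finset.mul_sum, mul_assoc]
    _ = ∑ t, if t₀ = t then E.E i (σ t) * star (E.E j t) else 0 := by
        refine Finset.sum_congr rfl fun t _ => ?_
        rw [hE, ← mul_assoc, (E.isCuntzFamily j).star_mul_eq_ite]
        simp only [τ.injective.eq_iff, ite_mul, one_mul, zero_mul]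
    _ = E.E i (σ t₀) * star (E.E j t₀) := by
        rw [Finset.sum_ite_eq, if_pos (Finset.mem_univ t₀)]

theorem LittlePullback.star_word_mul_E (hΛ : Λ.LittlePullback) {i : Fin k} {v : Λ.Word}
    (hv : Λ.d v i = 0) (a : Fin (Λ.m i)) :
    ∃ a' v', Λ.d v' = Λ.d v ∧ star (E.word v) * E.E i a = E.E i a' * star (E.word v') := by
  induction v using word_induction generalizing a with
  | one => exact ⟨a, 1, rfl, by simp⟩
  | e_mul j b v ih =>
    have hij : i ≠ j := by rintro rfl; simp at hv
    obtain ⟨a₁, b', hb'⟩ := hΛ.star_E_mul_E E hij a b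
    obtain ⟨a', v', hd, hv'⟩ := ih (by simpa [hij] using hv) a₁
    refine ⟨a', Λ.e j b' * v', by simp [hd], ?_⟩
    rw [map_mul, map_mul, CuntzRep.word_e, CuntzRep.word_e, star_mul, star_mul, mul_assoc, hb',
      ← mul_assoc, hv', mul_assoc]

namespace CuntzRep

/-- The ⋆-algebra generated by the operators `E^i_s`. -/
def starAlgebra : StarSubalgebra ℂ B :=
  StarAlgebra.adjoin ℂ {y | ∃ i s, y = E.E i s}

/-- The linear span of the elements `E_u E_v^*`, with no restriction on degrees. -/
noncomputable def wordSpan : Submodule ℂ B :=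
  Submodule.span ℂ {x | ∃ u v, x = E.word u * star (E.word v)}

variable {E}

theorem word_mul_star_word_mem_wordSpan (u v : Λ.Word) :
    E.word u * star (E.word v) ∈ E.wordSpan :=
  Submodule.subset_span ⟨u, v, rfl⟩

theorem mul_mem_wordSpan {b : B} (hb : ∀ u v, b * (E.word u * star (E.word v)) ∈ E.wordSpan)
    {x : B} (hx : x ∈ E.wordSpan) : b * x ∈ E.wordSpan := by
  have hle : E.wordSpan ≤ E.wordSpan.comap (LinearMap.mulLeft ℂ b) := by
    refine Submodule.span_le.2 ?_
    rintro _ ⟨u, v, rfl⟩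
    exact hb u v
  exact hle hx

theorem E_mul_mem_wordSpan (i : Fin k) (s : Fin (Λ.m i)) {x : B} (hx : x ∈ E.wordSpan) :
    E.E i s * x ∈ E.wordSpan := by
  refine mul_mem_wordSpan (fun u v => ?_) hx
  simpa [mul_assoc] using word_mul_star_word_mem_wordSpan (E := E) (Λ.e i s * u) v

end CuntzRep

variable {E}

theorem LittlePullback.star_E_mul_mem_wordSpan (hΛ : Λ.LittlePullback) (i : Fin k)
    (s : Fin (Λ.m i)) {x : B} (hx : x ∈ E.wordSpan) : star (E.E i s) * x ∈ E.wordSpan := by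
  refine CuntzRep.mul_mem_wordSpan (fun u v => ?_) hx
  induction u using word_induction generalizing s with
  | one =>
    rw [map_one, one_mul, ← star_mul, ← CuntzRep.word_e, ← map_mul]
    simpa only [map_one, one_mul] using CuntzRep.word_mul_star_word_mem_wordSpan 1 (v * Λ.e i s)
  | e_mul j t u ih =>
    rw [map_mul, CuntzRep.word_e, mul_assoc, ← mul_assoc]
    obtain rfl | hij := eq_or_ne i j
    · rw [(E.isCuntzFamily i).star_mul_eq_ite, ite_mul, one_mul, zero_mul]
      split_ifs
      · exact CuntzRep.word_mul_star_word_mem_wordSpan u v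
      · exact zero_mem _
    · obtain ⟨t', s', h⟩ := hΛ.star_E_mul_E E hij.symm t s
      rw [h, mul_assoc]
      exact CuntzRep.E_mul_mem_wordSpan _ _ (ih s')

theorem LittlePullback.mem_wordSpan (hΛ : Λ.LittlePullback) {x : B} (hx : x ∈ E.starAlgebra) :
    x ∈ E.wordSpan := by
  rw [CuntzRep.starAlgebra, ← StarSubalgebra.mem_toSubalgebra, StarAlgebra.adjoin_toSubalgebra,
    ← Subalgebra.mem_toSubmodule, Algebra.adjoin_eq_span] at hx
  refine Submodule.span_le.2 (fun y hy => ?_) hx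
  induction hy using Submonoid.closure_induction_left with
  | one => simpa using CuntzRep.word_mul_star_word_mem_wordSpan (E := E) 1 1
  | mul_left z hz y _ ih =>
    rcases hz with ⟨i, s, rfl⟩ | ⟨i, s, hz⟩
    · exact CuntzRep.E_mul_mem_wordSpan i s ih
    · rw [← star_star z, hz]
      exact hΛ.star_E_mul_mem_wordSpan i s ih

end WordSpan

namespace CuntzRep

section ColourMean

variable (E : Λ.CuntzRep B)

/-- The average `Φ_i(A) = m_i⁻¹ ∑ s, (E^i_s)^* A E^i_s` over the generators of colour `i`. -/
noncomputable def colourMean (i : Fin k) : Module.End ℂ B :=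
  compressionMean (E.E i)

theorem commute_colourMean (i j : Fin k) : Commute (E.colourMean i) (E.colourMean j) := by
  wlog h : i ≤ j generalizing i j
  · exact (this j i (le_of_not_ge h)).symm
  obtain rfl | h := h.eq_or_lt
  · exact Commute.refl _
  have hθ : (fun p : Fin (Λ.m i) × Fin (Λ.m j) => E.E i p.1 * E.E j p.2) =
      (fun q : Fin (Λ.m j) × Fin (Λ.m i) => E.E j q.1 * E.E i q.2) ∘
        (Λ.θ h).trans (Equiv.prodComm _ _) :=
    funext fun p => E.comm h p.1 _ p.2 _ rfl
  calc E.colourMean i * E.colourMean j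
      = compressionMean fun q : Fin (Λ.m j) × Fin (Λ.m i) => E.E j q.1 * E.E i q.2 :=
        compressionMean_mul_compressionMean _ _
    _ = compressionMean fun p : Fin (Λ.m i) × Fin (Λ.m j) => E.E i p.1 * E.E j p.2 := by
        rw [hθ, compressionMean_comp_equiv]
    _ = E.colourMean j * E.colourMean i := (compressionMean_mul_compressionMean _ _).symm

/-- The monoid of operators generated by the averages `Φ_i`, which plays the role of the
semigroup in a mean ergodic theorem. -/
noncomputable def meanMonoid : Submonoid (Module.End ℂ B) :=
  Submonoid.closure (Set.range E.colourMean)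

theorem colourMean_mem_meanMonoid (i : Fin k) : E.colourMean i ∈ E.meanMonoid :=
  Submonoid.subset_closure ⟨i, rfl⟩

theorem isCommContractive : IsCommContractive E.meanMonoid (ℂ ∙ (1 : B)) := by
  refine .closure ?_ ?_ ?_
  · rintro _ ⟨i, rfl⟩ _ ⟨j, rfl⟩
    exact E.commute_colourMean i j
  · rintro _ ⟨i, rfl⟩
    exact (E.isCuntzFamily i).norm_compressionMean_le
  · rintro _ ⟨i, rfl⟩ c hc
    obtain ⟨z, rfl⟩ := Submodule.mem_span_singleton.1 hc
    rw [map_smul, colourMean, (E.isCuntzFamily i).compressionMean_one]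

variable {E}

theorem exists_words_of_mem_meanMonoid {φ : Module.End ℂ B} (hφ : φ ∈ E.meanMonoid) :
    ∃ (ι : Type) (_ : Fintype ι) (T : ι → Λ.Word), (∀ a b, Λ.d (T a) = Λ.d (T b)) ∧
      IsCuntzFamily (fun a => E.word (T a)) ∧ φ = compressionMean fun a => E.word (T a) := by
  induction hφ using Submonoid.closure_induction with
  | mem φ h =>
    obtain ⟨i, rfl⟩ := h
    exact ⟨Fin (Λ.m i), inferInstance, Λ.e i, by simp, E.isCuntzFamily i, rfl⟩
  | one =>
    refine ⟨Unit, inferInstance, 1, by simp, ⟨by simp, by simp, by simp⟩, ?_⟩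
    ext A
    simp [compressionMean_apply]
  | mul φ ψ _ _ hφ hψ =>
    obtain ⟨ι, _, T, hdT, hT, rfl⟩ := hφ
    obtain ⟨κ, _, S, hdS, hS, rfl⟩ := hψ
    refine ⟨κ × ι, inferInstance, fun p => S p.1 * T p.2, fun p q => ?_, ?_, ?_⟩
    · rw [d_mul, d_mul, hdS p.1 q.1, hdT p.2 q.2]
    · simpa only [map_mul] using hS.mul hT
    · simp only [map_mul, compressionMean_mul_compressionMean]

theorem star_mem_attracted {x : B} (hx : x ∈ E.isCommContractive.attracted) :
    star x ∈ E.isCommContractive.attracted := fun ε hε => by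
  obtain ⟨φ, hφ, c, hc, h⟩ := hx ε hε
  obtain ⟨z, rfl⟩ := Submodule.mem_span_singleton.1 hc
  refine ⟨φ, hφ, star z • 1, Submodule.smul_mem _ _ (Submodule.mem_span_singleton_self 1), ?_⟩
  obtain ⟨ι, _, T, -, -, rfl⟩ := exists_words_of_mem_meanMonoid hφ
  rw [← star_compressionMean, ← norm_star]
  simpa only [star_sub, star_star, star_smul, star_one] using h

variable (E) in
theorem colourMean_E_mul (i : Fin k) (a : Fin (Λ.m i)) (x : B) :
    E.colourMean i (E.E i a * x) = (Λ.m i : ℂ)⁻¹ • (x * E.E i a) := by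
  have hterm (t : Fin (Λ.m i)) : star (E.E i t) * (E.E i a * x) * E.E i t =
      if t = a then x * E.E i t else 0 := by
    rw [← mul_assoc, (E.isCuntzFamily i).star_mul_eq_ite]
    split_ifs <;> simp
  simp only [colourMean, compressionMean_apply, Fintype.card_fin, hterm, Finset.sum_ite_eq',
    Finset.mem_univ, if_true]

variable (E) in
theorem colourMean_E_mul_star_E (i : Fin k) (a b : Fin (Λ.m i)) (x : B) :
    E.colourMean i (E.E i a * x * star (E.E i b)) =
      (if b = a then (Λ.m i : ℂ)⁻¹ else 0) • x := by
  rw [mul_assoc, colourMean_E_mul, mul_assoc, (E.isCuntzFamily i).star_mul_eq_ite]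
  split_ifs <;> simp

end ColourMean

end CuntzRep

variable {E : Λ.CuntzRep B}

theorem LittlePullback.exists_colourMean_word_mul_star_word (hΛ : Λ.LittlePullback) {i : Fin k}
    {u v : Λ.Word} (hu : Λ.d u i ≠ 0) (hv : Λ.d v i = 0) :
    ∃ u' v', Λ.d u' i ≠ 0 ∧ Λ.d v' i = 0 ∧ E.colourMean i (E.word u * star (E.word v)) =
      (Λ.m i : ℂ)⁻¹ • (E.word u' * star (E.word v')) := by
  obtain ⟨a, u, rfl⟩ := exists_eq_e_mul i u hu
  obtain ⟨a', v', hd, h⟩ := hΛ.star_word_mul_E E hv a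
  refine ⟨u * Λ.e i a', v', by simp, by rw [hd, hv], ?_⟩
  rw [map_mul E.word, map_mul E.word, CuntzRep.word_e, CuntzRep.word_e, mul_assoc,
    CuntzRep.colourMean_E_mul, mul_assoc, h, mul_assoc]

theorem LittlePullback.norm_colourMean_pow_le (hΛ : Λ.LittlePullback) {i : Fin k} (L : ℕ)
    {u v : Λ.Word} (hu : Λ.d u i ≠ 0) (hv : Λ.d v i = 0) :
    ‖(E.colourMean i ^ L) (E.word u * star (E.word v))‖ ≤ (Λ.m i : ℝ)⁻¹ ^ L := by
  induction L generalizing u v with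
  | zero =>
    have hnorm (w : Λ.Word) : ‖E.word w‖ ≤ 1 :=
      norm_le_one_of_star_mul_self_eq_one (E.star_word_mul_word_self w)
    calc ‖E.word u * star (E.word v)‖ ≤ ‖E.word u‖ * ‖star (E.word v)‖ := norm_mul_le _ _
      _ ≤ 1 := by
        rw [norm_star]
        exact mul_le_one₀ (hnorm u) (norm_nonneg _) (hnorm v)
  | succ L ih =>
    obtain ⟨u', v', hu', hv', h⟩ := hΛ.exists_colourMean_word_mul_star_word (E := E) hu hv
    rw [pow_succ, Module.End.mul_apply, h, map_smul, norm_smul, pow_succ', norm_inv,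
      Complex.norm_natCast]
    gcongr
    exact ih hu' hv'

theorem LittlePullback.mem_attracted_of_d_eq_zero (hΛ : Λ.LittlePullback) {i : Fin k}
    (hm : 2 ≤ Λ.m i) {u v : Λ.Word} (hu : Λ.d u i ≠ 0) (hv : Λ.d v i = 0) :
    E.word u * star (E.word v) ∈ E.isCommContractive.attracted := fun ε hε => by
  have hlt : (Λ.m i : ℝ)⁻¹ < 1 := inv_lt_one_of_one_lt₀ (by exact_mod_cast hm)
  obtain ⟨L, hL⟩ := exists_pow_lt_of_lt_one hε hlt
  refine ⟨E.colourMean i ^ L, pow_mem (E.colourMean_mem_meanMonoid i) L, 0, zero_mem _, ?_⟩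
  rw [sub_zero]
  exact (hΛ.norm_colourMean_pow_le L hu hv).trans_lt hL

theorem LittlePullback.word_mul_star_word_mem_attracted (hΛ : Λ.LittlePullback)
    (hm : ∀ i, 2 ≤ Λ.m i) (u v : Λ.Word) :
    E.word u * star (E.word v) ∈ E.isCommContractive.attracted := by
  induction u using word_induction generalizing v with
  | one =>
    induction v using word_induction with
    | one =>
      refine E.isCommContractive.le_attracted ?_
      simp
    | e_mul j b v _ =>
      simpa using CuntzRep.star_mem_attracted
        (hΛ.mem_attracted_of_d_eq_zero (E := E) (hm j) (u := Λ.e j b * v) (v := 1) (by simp)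
          (by simp))
  | e_mul j a u ih =>
    by_cases hv : Λ.d v j = 0
    · exact hΛ.mem_attracted_of_d_eq_zero (hm j) (by simp) hv
    · obtain ⟨b, v, rfl⟩ := exists_eq_e_mul j v hv
      refine E.isCommContractive.mem_attracted_of_apply_mem (E.colourMean_mem_meanMonoid j) ?_
      have h : E.colourMean j (E.word (Λ.e j a * u) * star (E.word (Λ.e j b * v))) =
          (if b = a then (Λ.m j : ℂ)⁻¹ else 0) • (E.word u * star (E.word v)) := by
        rw [← E.colourMean_E_mul_star_E]
        simp [mul_assoc]
      rw [h]
      exact Submodule.smul_mem _ _ (ih v)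

theorem LittlePullback.mem_attracted (hΛ : Λ.LittlePullback) (hm : ∀ i, 2 ≤ Λ.m i) {A : B}
    (hA : A ∈ closure (E.starAlgebra : Set B)) : A ∈ E.isCommContractive.attracted := by
  have hspan : E.wordSpan ≤ E.isCommContractive.attracted := by
    refine Submodule.span_le.2 ?_
    rintro _ ⟨u, v, rfl⟩
    exact hΛ.word_mul_star_word_mem_attracted hm u v
  exact closure_minimal (fun x hx => hspan (hΛ.mem_wordSpan hx))
    E.isCommContractive.isClosed_attracted hA

namespace CuntzRep

/-- The unitaries in the span of the elements `E_u E_v^*` with `d(u) = d(v)`; for the universal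
representation this is `𝒰(𝒳₀)`. -/
def coreUnitary (E : Λ.CuntzRep B) : Set (unitary B) :=
  {U | (U : B) ∈ Submodule.span ℂ {x | ∃ u v, Λ.d u = Λ.d v ∧ x = E.word u * star (E.word v)}}

variable (E) in
theorem exists_mem_Ave_norm_sub_lt {A : B} (hA : A ∈ E.isCommContractive.attracted) {ε : ℝ}
    (hε : 0 < ε) : ∃ α ∈ Ave B E.coreUnitary, ∃ c ∈ ℂ ∙ (1 : B), ‖α A - c‖ < ε := by
  obtain ⟨φ, hφ, c, hc, h⟩ := hA ε hε
  obtain ⟨ι, _, T, hd, hT, rfl⟩ := exists_words_of_mem_meanMonoid hφ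
  refine ⟨_, hT.dilation_compressionMean_mem_Ave fun U hU => ?_, c, hc, ?_⟩
  · refine Submodule.span_mono ?_ hU
    rintro _ ⟨a, b, rfl⟩
    exact ⟨T a, T b, hd a b, rfl⟩
  · have hdil : hT.dilation c = c := by
      obtain ⟨z, rfl⟩ := Submodule.mem_span_singleton.1 hc
      rw [map_smul, map_one]
    calc ‖hT.dilation (compressionMean (fun a => E.word (T a)) A) - c‖
        = ‖hT.dilation (compressionMean (fun a => E.word (T a)) A - c)‖ := by rw [map_sub, hdil]
      _ ≤ ‖compressionMean (fun a => E.word (T a)) A - c‖ :=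
        NonUnitalStarAlgHom.norm_apply_le hT.dilation _
      _ < ε := h

end CuntzRep

variable (Λ)

theorem coreUnitary_univRep : Λ.univRep.coreUnitary = Λ.unitaryX₀ := by
  ext U
  simp only [CuntzRep.coreUnitary, unitaryX₀, X, sw, Pi.zero_apply, sub_eq_zero, Nat.cast_inj,
    funext_iff]

theorem dense_starAlgebra_univRep : Dense (Λ.univRep.starAlgebra : Set Λ.O) := fun A => by
  have himage : Λ.toBig '' {y | ∃ i s, y = Λ.univRep.E i s} = {x | ∃ i s, x = Λ.bigGen i s} := by
    ext x
    constructor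
    · rintro ⟨_, ⟨i, s, rfl⟩, rfl⟩
      exact ⟨i, s, rfl⟩
    · rintro ⟨i, s, rfl⟩
      exact ⟨_, ⟨i, s, rfl⟩, rfl⟩
  have hA : Λ.toBig A ∈ closure (Λ.toBig '' Λ.univRep.starAlgebra) := by
    rw [← StarSubalgebra.coe_map, CuntzRep.starAlgebra, StarAlgHom.map_adjoin, himage]
    exact A.2
  have hind : Topology.IsInducing Λ.toBig := Topology.IsInducing.subtypeVal
  rw [hind.closure_eq_preimage_closure_image]
  exact hA

end SingleVertexKGraph

theorem mainTheorem4_general {k : ℕ} {Λ : SingleVertexKGraph k} {B : Type*} [CStarAlgebra B]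
    (E : Λ.CuntzRep B) (hm : ∀ i, 2 ≤ Λ.m i) (hΛ : Λ.LittlePullback) {A : B}
    (hA : A ∈ closure (E.starAlgebra : Set B)) :
    (closure {C : B | ∃ α ∈ Ave B E.coreUnitary, C = α A} ∩
      Set.range (fun z : ℂ => z • (1 : B))).Nonempty := by
  have hbdd : Bornology.IsBounded {C : B | ∃ α ∈ Ave B E.coreUnitary, C = α A} := by
    refine isBounded_iff_forall_norm_le.2 ⟨‖A‖, ?_⟩
    rintro _ ⟨α, hα, rfl⟩
    exact norm_apply_le_of_mem_Ave hα A
  rw [← Submodule.span_singleton_eq_range]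
  refine closure_inter_nonempty_of_forall_exists_norm_sub_lt hbdd (ℂ ∙ (1 : B)) fun ε hε => ?_
  obtain ⟨α, hα, c, hc, h⟩ := E.exists_mem_Ave_norm_sub_lt (hΛ.mem_attracted hm hA) hε
  exact ⟨α A, ⟨α, hα, rfl⟩, c, hc, h⟩

theorem mainTheorem4 {k : ℕ} (Λ : SingleVertexKGraph k) (hm : ∀ i, 2 ≤ Λ.m i)
    (hΛ : Λ.LittlePullback) (A : Λ.O) :
    (closure {B : Λ.O | ∃ α ∈ Ave Λ.O Λ.unitaryX₀, B = α A} ∩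
      Set.range (fun z : ℂ => z • (1 : Λ.O))).Nonempty := by
  rw [← Λ.coreUnitary_univRep]
  exact mainTheorem4_general Λ.univRep hm hΛ (Λ.dense_starAlgebra_univRep A)
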